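/- Let $M\subseteq\mathbb R^d$ be open with volume form $\Omega=dx_1\cdots dx_d$, and let $\mathfrak g_S^\Omega=\mathfrak g_S[v]$ be the differential graded Lie algebra of multivector fields on $M$ with the Schouten bracket and the differential $v\,\mathrm{div}_\Omega$, where $|v|=2$. Let $\tilde\pi=\pi+vh$ be a Maurer–Cartan element of degree 1: $\pi=\frac12\sum\pi^{\mu\nu}\partial_\mu\wedge\partial_\nu$ is a smooth bivector field and $h$ a smooth function on $M$ with $$[\pi,\pi]=0,\qquad \mathrm{div}_\Omega\pi=[h,\pi],\qquad\text{i.e. } \sum_i\partial_i\pi^{ij}=\sum_i\pi^{ji}\partial_ih \text{ for all } j .$$ Put $\tilde\pi_\epsilon=\epsilon\pi+vh$. For $\gamma_i=\pi_i+vh_i$ of degree 1 and a function $f$, let $F_n(\gamma_1,\dots,\gamma_n;f)$ be the following smooth function on $M$ (the function component of the $n$-th Taylor component of the Feynman-graph $L_\infty$-morphism; only this component contributes to integrals against $\Omega$): $$F_n(\gamma_1,\dots,\gamma_n;f)=\sum_\Gamma w_\Gamma F_\Gamma .$$ The sum is over directed graphs $\Gamma$ with vertices $1,\dots,n,\bar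 0$, without loops or multiple edges, together with a set $S\subseteq\{1,\dots,n\}$, such that two ordered edges start at each $i\in S$ and no edge starts at any other vertex. The function $F_\Gamma$ is obtained by placing $\pi_i$ at each $i\in S$, $h_i$ at each $i\in\{1,\dots,n\}\setminus S$ and $f$ at $\bar 0$, letting each edge from $i$ with index $\nu$ be the contraction of the corresponding upper index $\nu$ of $\pi_i$ with $\partial_\nu$ acting on the coefficients at its endpoint, and multiplying. The weight is $$w_\Gamma=\frac1{2^{|S|}}\int_{\{z\in D^n:\ z_i\ne z_j\ (i\neq j)\}}\ \prod_{i\in S}\omega(z_i,z_{a_i})\,\omega(z_i,z_{b_i})\prod_{i\notin S}\tfrac{\mathrm i}{2\pi}dz_i\wedge d\bar z_i ,$$ where $D$ is the open unit disk, $D^n$ is oriented by $\prod_j d\,\mathrm{Re}\,z_j\wedge d\,\mathrm{Im}\,z_j$, $a_i,b_i$ are the endpoints of the first and second edge from $i$, $z_{\bar 0}=1$, and $$\omega(z,w)=\frac1{4\pi \mathrm i}\Big(d\ln\frac{(z-w)(1-z\bar w)}{(\bar z-\bar w)(1-\bar zw)}+z\,d\bar z-\bar z\,dz\Big).$$ Extend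 $F_n$ by $\mathbb R[[\epsilon]]$-multilinearity. For $f\in C_c^\infty(M)$ set $$\tau(f)=\sum_{n\ge0}\frac1{n!}\int_MF_n(\tilde\pi_\epsilon,\dots,\tilde\pi_\epsilon;f)\,\Omega\in\mathbb R[[\epsilon]].$$ **Proposition.** For each $d$ there are differential polynomials $H_n$, $n\ge0$ (polynomials with constant real coefficients, depending only on $d$ and $n$, in the partial derivatives of all orders of the components of $\pi$, of $h$ and of $f$), such that for all $M$, $\pi+vh$ and $f\in C_c^\infty(M)$ as above: 1. $\tau(f)$ is well defined: for each $k$ the coefficient of $\epsilon^k$ in $F_n(\tilde\pi_\epsilon,\dots,\tilde\pi_\epsilon;f)$ is integrable on $M$ for every $n$, and the series over $n$ of $\frac1{n!}$ times these integrals converges. The infinitely many terms at order $\epsilon^k$ resum into exponentials: pointwise on $M$, the series over $n$ of $\frac1{n!}$ times these coefficients converges to $\frac1{k!}H_k(\pi,h,f)\,e^h$. 2. Each $H_n(\pi,h,f)\,e^h$ is integrable on $M$, and $$\tau(f)=\sum_{n\ge0}\frac{\epsilon^n}{n!}\int_MH_n(\pi,h,f)\,e^h\,\Omega=\int_Mf\,e^h\,\Omega+O(\epsilon).$$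 -/

import Mathlib

open MeasureTheory

noncomputable section

namespace CyclicTrace

/-! ## Degree one elements of `g_S[v]` on an open subset of `ℝ^d` -/

/-- An element `π + v h` of degree one of `g_S^Ω = g_S[v]`, in the standard coordinates of `ℝ^d`:
`biv` holds the components `π^{μν}` of `π = 1/2 ∑ π^{μν} ∂_μ ∧ ∂_ν`, and `fn` is `h`.
Only the values on the open set under consideration matter. -/
structure DegOne (d : ℕ) where
  biv : Fin d → Fin d → (Fin d → ℝ) → ℝ
  fn : (Fin d → ℝ) → ℝ

/-- The partial derivative `∂_ν g`. -/
def partialD {d : ℕ} (ν : Fin d) (g : (Fin d → ℝ) → ℝ) : (Fin d → ℝ) → ℝ :=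
  fun x => fderiv ℝ g x (Pi.single ν 1)

/-- The iterated partial derivative `∂^α g = ∂_1^{α_1} ⋯ ∂_d^{α_d} g`. -/
def multiD {d : ℕ} (α : Fin d → ℕ) (g : (Fin d → ℝ) → ℝ) : (Fin d → ℝ) → ℝ :=
  (List.finRange d).foldr (fun ν g₁ => (partialD ν)^[α ν] g₁) g

/-- The components of the trivector field `[π, π]` (Schouten--Nijenhuis bracket), up to a nonzero
constant factor: the cyclic sum `∑_l (π^{il} ∂_l π^{jk} + π^{jl} ∂_l π^{ki} + π^{kl} ∂_l π^{ij})`. -/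
def schoutenSquare {d : ℕ} (p : Fin d → Fin d → (Fin d → ℝ) → ℝ) (i j k : Fin d)
    (x : Fin d → ℝ) : ℝ :=
  ∑ l, (p i l x * partialD l (p j k) x + p j l x * partialD l (p k i) x
    + p k l x * partialD l (p i j) x)

/-- The `j`-th component `∑_i ∂_i π^{ij}` of the vector field `div_Ω π`, where
`Ω = dx_1 ⋯ dx_d`; in the odd variables `θ_i = ∂_i` one has `div_Ω = ∑ ∂²/∂x_i ∂θ_i`. -/
def divBiv {d : ℕ} (p : Fin d → Fin d → (Fin d → ℝ) → ℝ) (j : Fin d) (x : Fin d → ℝ) : ℝ :=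
  ∑ i, partialD i (p i j) x

/-- The `j`-th component `∑_i π^{ji} ∂_i h` of the vector field `[h, π] = [π, h]`
(by the Leibniz rule, `[∂_a ∧ ∂_b, h] = (∂_b h) ∂_a - (∂_a h) ∂_b`). -/
def bracketFnBiv {d : ℕ} (h : (Fin d → ℝ) → ℝ) (p : Fin d → Fin d → (Fin d → ℝ) → ℝ) (j : Fin d)
    (x : Fin d → ℝ) : ℝ :=
  ∑ i, p j i x * partialD i h x

/-- `γ = π + v h` is a Maurer--Cartan element of `g_S^Ω(M)`: `π` is a smooth bivector field and `h`
a smooth function on `M`, and `v div_Ω π - 1/2 [π + v h, π + v h] = 0`, that is, `[π, π] = 0` and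
`div_Ω π = [h, π]`. -/
structure IsMaurerCartan {d : ℕ} (M : Set (Fin d → ℝ)) (γ : DegOne d) : Prop where
  smooth_biv : ∀ i j, ContDiffOn ℝ (⊤ : ℕ∞) (γ.biv i j) M
  smooth_fn : ContDiffOn ℝ (⊤ : ℕ∞) γ.fn M
  skew : ∀ i j, ∀ x ∈ M, γ.biv i j x = -γ.biv j i x
  poisson : ∀ i j k, ∀ x ∈ M, schoutenSquare γ.biv i j k x = 0
  unimodular : ∀ j, ∀ x ∈ M, divBiv γ.biv j x = bracketFnBiv γ.fn γ.biv j x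

/-! ## The propagator, graphs and weights -/

/-- The propagator, a 1-form on pairs of distinct points of the closed disk,
`ω(z,w) = (1/4πi) (d ln [(z-w)(1-z w̄) / ((z̄-w̄)(1-z̄ w))] + z dz̄ - z̄ dz)`,
evaluated at the point `(z, w)` on the tangent vector `(dz, dw)`. The complex number whose real
part is taken is real, being of the form `(c - c̄) / (4πi)`. -/
def propagator (z w dz dw : ℂ) : ℝ :=
  ((1 / (4 * (Real.pi : ℂ) * Complex.I)) *
    ((dz - dw) / (z - w)
      + (-(dz * star w + z * star dw)) / (1 - z * star w)
      - (star dz - star dw) / (star z - star w)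
      - (-(star dz * w + star z * dw)) / (1 - star z * w)
      + z * star dz - star z * dz)).re

/-- The configuration space `C⁰_{V,0}(D)` of distinct points of the open unit disk labelled by `V`
(there is one more point, fixed at `1` on the boundary circle). It is an open subset of `ℂ^V`,
oriented by `∏ d Re z_j ∧ d Im z_j`. -/
def config (V : Type) : Set (V → ℂ) :=
  {z | (∀ i, ‖z i‖ < 1) ∧ Function.Injective z}

/-- Graphs without white vertices with set `V` of vertices of the first type and a single vertex
of the second type, denoted `none`. Exactly two ordered edges originate at each `i ∈ S` (these
vertices carry a bivector field and have degree `0`), no edge originates at a vertex outside `S`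
(these vertices carry a function times `v` and have degree `1`). `Γ.1 i a` is the vertex at which
the `a`-th edge from `i` ends. There are no loops and no multiple edges. -/
abbrev FGraph {V : Type} (S : Finset V) : Type :=
  {t : S → Fin 2 → Option V // (∀ i a, t i a ≠ some i.1) ∧ ∀ i, t i 0 ≠ t i 1}

/-- The point of the closed disk assigned to a vertex of a graph. -/
def vertexPos {V : Type} (z : V → ℂ) : Option V → ℂ
  | none => 1
  | some j => z j

/-- The component at a vertex of a graph of a tangent vector of the configuration space. -/
def vertexVel {V : Type} (v : V → ℂ) : Option V → ℂ
  | none => 0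
  | some j => v j

/-- The 1-forms whose wedge product, in the order `(i,0), (i,1)` for every `i`, is the form
`ω_Γ`, as functions of the point `z` and the tangent vector `v`. A vertex `i ∈ S` contributes
`ω(z_i, z_a) ∧ ω(z_i, z_b)` where `a`, `b` are the endpoints of its edges, and a vertex `i ∉ S`
contributes the 2-form part `(i/2π) dz_i ∧ dz̄_i = (1/π) d Re z_i ∧ d Im z_i` of `φ(z_i,u)`. The
0-form part `u (1-|z_i|²)` of `φ(z_i,u)` does not contribute to forms of top degree since the
number of edges is twice the cardinality of `S`. -/
def rowForm {V : Type} [DecidableEq V] (S : Finset V) (Γ : FGraph S) (z : V → ℂ) (r : V × Fin 2)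
    (v : V → ℂ) : ℝ :=
  if hr : r.1 ∈ S then
    propagator (z r.1) (vertexPos z (Γ.1 ⟨r.1, hr⟩ r.2)) (v r.1)
      (vertexVel v (Γ.1 ⟨r.1, hr⟩ r.2))
  else if r.2 = 0 then (v r.1).re / Real.pi else (v r.1).im

/-- The standard oriented frame `∂/∂Re z_j, ∂/∂Im z_j` of `ℂ^V`. -/
def frame {V : Type} [DecidableEq V] (c : V × Fin 2) : V → ℂ :=
  Pi.single c.1 (if c.2 = 0 then 1 else Complex.I)

/-- The coefficient of `∏ d Re z_j ∧ d Im z_j` in the form `ω_Γ`: the value of a wedge product of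
1-forms on a frame is the determinant of the matrix of the values of the 1-forms. -/
def topCoeff {V : Type} [Fintype V] [DecidableEq V] (S : Finset V) (Γ : FGraph S) (z : V → ℂ) : ℝ :=
  (Matrix.of fun r c : V × Fin 2 => rowForm S Γ z r (frame c)).det

/-- The weight `w_Γ = (∏ k_i!)⁻¹ ∫ ω_Γ` of a graph, where `k_i = 2` for `i ∈ S` and `k_i = 0`
otherwise. -/
def weight {V : Type} [Fintype V] [DecidableEq V] (S : Finset V) (Γ : FGraph S) : ℝ :=
  (1 / 2 ^ S.card) * ∫ z in config V, topCoeff S Γ z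

/-- For a labelling `I` of the edges of `Γ` by coordinate indices and a vertex `a`, the multi-index
counting the edges ending at `a` with each label. -/
def incoming {V : Type} [DecidableEq V] {d : ℕ} (S : Finset V) (Γ : FGraph S)
    (I : S × Fin 2 → Fin d) (a : Option V) : Fin d → ℕ :=
  fun ν => (Finset.univ.filter fun e : S × Fin 2 => Γ.1 e.1 e.2 = a ∧ I e = ν).card

/-- The function `F_Γ(γ; f)`: sum over the labellings `I` of the edges by coordinate indices, of
the product over the vertices of the component of the tensor placed at the vertex, with upper
indices the labels of the outgoing edges, differentiated with respect to the labels of the incoming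
edges. -/
def graphTerm {V : Type} [Fintype V] [DecidableEq V] {d : ℕ} (S : Finset V) (Γ : FGraph S)
    (γ : V → DegOne d) (f : (Fin d → ℝ) → ℝ) (x : Fin d → ℝ) : ℝ :=
  ∑ I : S × Fin 2 → Fin d,
    (∏ i : S, multiD (incoming S Γ I (some i.1)) ((γ i.1).biv (I (i, 0)) (I (i, 1))) x)
    * (∏ i ∈ Sᶜ, multiD (incoming S Γ I (some i)) (γ i).fn x)
    * multiD (incoming S Γ I none) f x

/-- The function component of `F_n(γ_1, …, γ_n; f) = ∑_Γ w_Γ F_Γ(γ_1, …, γ_n; f)` for elements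
`γ_i = π_i + v h_i` of degree one. White vertices produce the components in `Γ(∧^k TM)`, `k > 0`,
whose integral against `Ω` is zero, so the graphs are those without white vertices; they are sorted
by the set `S` of the vertices at which the term `π_i` of `γ_i` is placed, the term `v h_i` being
placed at the other ones. -/
def F {d : ℕ} (n : ℕ) (γ : Fin n → DegOne d) (f : (Fin d → ℝ) → ℝ) (x : Fin d → ℝ) : ℝ :=
  ∑ S : Finset (Fin n), ∑ Γ : FGraph S, weight S Γ * graphTerm S Γ γ f x

/-! ## The formal parameter and the functional `τ` -/

/-- The extension of `F_n` by `ℝ[[ε]]`-multilinearity to formal power series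
`γ_i = ∑_k ε^k γ_{i,k}` of elements of degree one. -/
def FEps {d : ℕ} (n : ℕ) (γ : Fin n → ℕ → DegOne d) (f : (Fin d → ℝ) → ℝ) (x : Fin d → ℝ) :
    PowerSeries ℝ :=
  PowerSeries.mk fun k =>
    ∑ κ ∈ Finset.Nat.antidiagonalTuple n k, F n (fun i => γ i (κ i)) f x

/-- The formal power series `ε π + v h`, for `γ = π + v h`. -/
def epsTwist {d : ℕ} (γ : DegOne d) : ℕ → DegOne d
  | 0 => ⟨fun _ _ _ => 0, γ.fn⟩
  | 1 => ⟨γ.biv, fun _ => 0⟩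
  | _ => ⟨fun _ _ _ => 0, fun _ => 0⟩

/-- The coefficient of `ε^k` in the function `F_n(ε π + v h, …, ε π + v h; f)`. -/
def FCoeff {d : ℕ} (γ : DegOne d) (f : (Fin d → ℝ) → ℝ) (n k : ℕ) (x : Fin d → ℝ) : ℝ :=
  PowerSeries.coeff k (FEps n (fun _ => epsTwist γ) f x)

/-- `τ(f) = ∑_n (1/n!) ∫_M F_n(ε π + v h, …, ε π + v h; f) Ω`, a formal power series in `ε`
each coefficient of which is an infinite sum. -/
def tau {d : ℕ} (M : Set (Fin d → ℝ)) (γ : DegOne d) (f : (Fin d → ℝ) → ℝ) : PowerSeries ℝ :=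
  PowerSeries.mk fun k =>
    ∑' n : ℕ, (1 / (n.factorial : ℝ)) * ∫ x in M, FCoeff γ f n k x

/-! ## Differential polynomials -/

/-- The jet variables: `∂^α π^{μν}`, `∂^α h` and `∂^α f`. -/
inductive JetVar (d : ℕ) : Type
  | piVar (μ ν : Fin d) (α : Fin d → ℕ) : JetVar d
  | hVar (α : Fin d → ℕ) : JetVar d
  | fVar (α : Fin d → ℕ) : JetVar d

/-- The values of the jet variables at a point. -/
def jetValue {d : ℕ} (γ : DegOne d) (f : (Fin d → ℝ) → ℝ) (x : Fin d → ℝ) : JetVar d → ℝ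
  | .piVar μ ν α => multiD α (γ.biv μ ν) x
  | .hVar α => multiD α γ.fn x
  | .fVar α => multiD α f x

/-- Differential polynomials in `π`, `h`, `f` with constant real coefficients. -/
abbrev DiffPoly (d : ℕ) : Type := MvPolynomial (JetVar d) ℝ

/-- The function `P(π, h, f)` defined by a differential polynomial `P`. -/
def DiffPoly.apply {d : ℕ} (P : DiffPoly d) (γ : DegOne d) (f : (Fin d → ℝ) → ℝ)
    (x : Fin d → ℝ) : ℝ :=
  MvPolynomial.eval (jetValue γ f x) P

end CyclicTrace

end

open CyclicTrace

open MeasureTheory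

noncomputable section

namespace CyclicTrace

/-! ## Embeddings of graphs -/

section Embedding

variable {V W U : Type}

/-! Only vertices carrying `h` make the series infinite, and all but boundedly many of them are
idle. Call a vertex touched if it carries a bivector field or some edge ends at it. A graph with `k`
bivector fields has `2k` edges, hence at most `3k` touched vertices. An untouched vertex contributes
an undifferentiated factor `h` to the function (`graphTerm_push`) and the integral of the normalised
area form of the disk, which is 1, to the weight (`weight_push`).

Every graph is therefore the image of a core, a graph with all vertices touched, under an embedding
of vertex sets. Grouping by the set of touched vertices, with `P_{m,k}` the weighted sum over cores
with `m` vertices, the coefficient of `ε^k` in `F_n` is `∑_{m ≤ 3k} C(n,m) h^(n-m) P_{m,k}`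
(`FCoeff_eq`). Since `C(n,m)/n! = 1/(m! (n-m)!)`, summation over `n` gives `e^h ∑_m P_{m,k}/m!`, so
`H_k = k! ∑_m P_{m,k}/m!`.

The same resummation holds for the integrals: each `P_{m,k}` vanishes off the compact support of
`f`, where `h` is bounded, and dominated convergence applies. At order zero only the empty graph is
left, and `H_0 = f`. -/

/-- The bijection of a finite set with its image under an embedding. -/
def imageEquiv (e : W ↪ V) (S : Finset W) : S ≃ S.map e :=
  Equiv.ofBijective (fun i => ⟨e i.1, Finset.mem_map_of_mem e i.2⟩)
    ⟨fun i j hij => Subtype.ext (e.injective (Subtype.ext_iff.1 hij)), fun j => by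
      obtain ⟨i, hi, hij⟩ := Finset.mem_map.1 j.2
      exact ⟨⟨i, hi⟩, Subtype.ext hij⟩⟩

@[simp]
theorem coe_imageEquiv (e : W ↪ V) (S : Finset W) (i : S) : (imageEquiv e S i : V) = e i.1 := rfl

/-- The image of a graph under an embedding of its set of vertices. -/
def FGraph.push (e : W ↪ V) {S : Finset W} (Γ : FGraph S) : FGraph (S.map e) :=
  ⟨fun i a => (Γ.1 ((imageEquiv e S).symm i) a).map e, by
    refine ⟨fun i a h => ?_, fun i h => ?_⟩
    · obtain ⟨j, rfl⟩ := (imageEquiv e S).surjective i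
      simp only [Equiv.symm_apply_apply, coe_imageEquiv] at h
      exact Γ.2.1 j a (Option.map_injective e.injective h)
    · exact Γ.2.2 _ (Option.map_injective e.injective h)⟩

theorem FGraph.push_apply (e : W ↪ V) {S : Finset W} (Γ : FGraph S) (i : S) (a : Fin 2) :
    (Γ.push e).1 (imageEquiv e S i) a = (Γ.1 i a).map e := by
  simp [FGraph.push]

theorem vertexPos_map (e : W → V) (z : V → ℂ) (o : Option W) :
    vertexPos z (o.map e) = vertexPos (z ∘ e) o := by
  cases o <;> rfl

theorem vertexVel_map (e : W → V) (z : V → ℂ) (o : Option W) :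
    vertexVel z (o.map e) = vertexVel (z ∘ e) o := by
  cases o <;> rfl

/-- The embedding of a summand of a decomposition of `V`. -/
abbrev inlEmb (σ : W ⊕ U ≃ V) : W ↪ V := Function.Embedding.inl.trans σ.toEmbedding

theorem inr_notMem_range_inlEmb (σ : W ⊕ U ≃ V) (u : U) :
    σ (Sum.inr u) ∉ Set.range (inlEmb σ) := by
  rintro ⟨w, hw⟩
  simp at hw

/-- The decomposition of the space of maps from a disjoint union. -/
def splitEquiv (σ : W ⊕ U ≃ V) : (V → ℂ) ≃ᵐ (W → ℂ) × (U → ℂ) :=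
  (MeasurableEquiv.piCongrLeft (fun _ => ℂ) σ).symm.trans
    (MeasurableEquiv.sumPiEquivProdPi fun _ => ℂ)

theorem splitEquiv_apply (σ : W ⊕ U ≃ V) (z : V → ℂ) :
    splitEquiv σ z = (z ∘ inlEmb σ, fun u => z (σ (Sum.inr u))) := rfl

theorem measurePreserving_splitEquiv [Fintype V] [Fintype W] [Fintype U]
    (σ : W ⊕ U ≃ V) :
    MeasurePreserving (splitEquiv σ) volume volume :=
  (volume_measurePreserving_sumPiEquivProdPi _).comp
    (volume_measurePreserving_piCongrLeft (fun _ => ℂ) σ).symm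

/-! ### The top-degree form of an embedded graph -/

variable [DecidableEq V]

theorem rowForm_push [DecidableEq W] (e : W ↪ V) {S : Finset W} (Γ : FGraph S) (z : V → ℂ) (w : W) (a : Fin 2)
    (v : V → ℂ) :
    rowForm (S.map e) (Γ.push e) z (e w, a) v = rowForm S Γ (z ∘ e) (w, a) (v ∘ e) := by
  by_cases hw : w ∈ S
  · have hw' : e w ∈ S.map e := Finset.mem_map_of_mem e hw
    have h := Γ.push_apply e ⟨w, hw⟩ a
    have h2 : imageEquiv e S ⟨w, hw⟩ = ⟨e w, hw'⟩ := rfl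
    rw [h2] at h
    simp only [rowForm, dif_pos hw, dif_pos hw', h, vertexPos_map, vertexVel_map,
      Function.comp_apply]
  · have hw' : e w ∉ S.map e := by simpa using hw
    simp [rowForm, hw]

theorem rowForm_push_of_notMem (e : W ↪ V) {S : Finset W} (Γ : FGraph S) (z : V → ℂ) (u : V)
    (hu : u ∉ Set.range e) (a : Fin 2) (v : V → ℂ) :
    rowForm (S.map e) (Γ.push e) z (u, a) v =
      if a = 0 then (v u).re / Real.pi else (v u).im := by
  have hu' : u ∉ S.map e := fun h => by
    obtain ⟨w, -, rfl⟩ := Finset.mem_map.1 h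
    exact hu ⟨w, rfl⟩
  simp only [rowForm, dif_neg hu']

theorem frame_comp_embedding [DecidableEq W] (e : W ↪ V) (w : W) (a : Fin 2) :
    frame (e w, a) ∘ e = frame (w, a) := by
  funext j
  simp [frame, Pi.single_apply, e.injective.eq_iff]

theorem frame_comp_embedding_of_notMem (e : W ↪ V) (u : V) (hu : u ∉ Set.range e) (a : Fin 2) :
    frame (u, a) ∘ e = 0 := by
  funext j
  have : e j ≠ u := fun h => hu ⟨j, h⟩
  simp [frame, this]

/-- This makes the rows of the old vertices vanish on the frame vectors of the added ones. -/
theorem rowForm_zero (S : Finset V) (Γ : FGraph S) (z : V → ℂ) (r : V × Fin 2) :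
    rowForm S Γ z r 0 = 0 := by
  have h : ∀ o : Option V, vertexVel 0 o = 0 := fun o => by cases o <;> rfl
  unfold rowForm
  split_ifs <;> simp [propagator, h]

variable [Fintype V] [Fintype W] [Fintype U]

/-- No edge meets an added vertex, so the matrix is block diagonal after splitting the vertices.
Rows and columns are reindexed by the same bijection, so no sign appears. The new block is diagonal,
with entries `1/π` and `1` for each added vertex. -/
theorem topCoeff_push [DecidableEq W] [DecidableEq U] (σ : W ⊕ U ≃ V) {S : Finset W} (Γ : FGraph S) (z : V → ℂ) :
    topCoeff (S.map (inlEmb σ)) (Γ.push (inlEmb σ)) z =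
      topCoeff S Γ (z ∘ inlEmb σ) * (1 / Real.pi) ^ Fintype.card U := by
  let ρ : W × Fin 2 ⊕ U × Fin 2 ≃ V × Fin 2 :=
    (Equiv.sumProdDistrib W U (Fin 2)).symm.trans (σ.prodCongr (Equiv.refl _))
  have key : (Matrix.of fun r c : V × Fin 2 =>
      rowForm (S.map (inlEmb σ)) (Γ.push (inlEmb σ)) z r (frame c)).submatrix ρ ρ =
      Matrix.fromBlocks
        (Matrix.of fun r c : W × Fin 2 => rowForm S Γ (z ∘ inlEmb σ) r (frame c)) 0 0
        (Matrix.diagonal fun r : U × Fin 2 => if r.2 = 0 then 1 / Real.pi else 1) := by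
    ext (⟨w, a⟩ | ⟨u, a⟩) (⟨w', b⟩ | ⟨u', b⟩)
    · change rowForm _ _ z (inlEmb σ w, a) (frame (inlEmb σ w', b)) = _
      rw [rowForm_push, frame_comp_embedding]
      rfl
    · change rowForm _ _ z (inlEmb σ w, a) (frame (σ (Sum.inr u'), b)) = _
      rw [rowForm_push, frame_comp_embedding_of_notMem _ _ (inr_notMem_range_inlEmb σ u'),
        rowForm_zero]
      rfl
    · change rowForm _ _ z (σ (Sum.inr u), a) (frame (inlEmb σ w', b)) = _
      rw [rowForm_push_of_notMem _ _ _ _ (inr_notMem_range_inlEmb σ u)]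
      simp [frame]
    · change rowForm _ _ z (σ (Sum.inr u), a) (frame (σ (Sum.inr u'), b)) = _
      rw [rowForm_push_of_notMem _ _ _ _ (inr_notMem_range_inlEmb σ u)]
      by_cases huu : u = u'
      · subst huu
        fin_cases a <;> fin_cases b <;> simp [frame]
      · simp [frame, huu]
  unfold topCoeff
  rw [← Matrix.det_submatrix_equiv_self ρ, key, Matrix.det_fromBlocks_zero₂₁, Matrix.det_diagonal,
    Fintype.prod_prod_type]
  simp

/-! ## Weights -/

/-- The diagonals are proper real subspaces, hence null. Unlike the configuration space, the
polydisk is a product over the vertices, as Fubini requires. -/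
theorem config_ae_eq_ball :
    config V =ᵐ[volume] Set.pi Set.univ fun _ : V => Metric.ball (0 : ℂ) 1 := by
  have hdiag : ∀ i j : V, i ≠ j → ∀ᵐ z : V → ℂ, z i ≠ z j := by
    intro i j hij
    let p : Submodule ℝ (V → ℂ) :=
      LinearMap.ker (LinearMap.proj (R := ℝ) (φ := fun _ : V => ℂ) i - LinearMap.proj j)
    have hp : p ≠ ⊤ := fun h => by
      have : (Pi.single i 1 : V → ℂ) ∈ p := h ▸ Submodule.mem_top
      simp [p, hij.symm] at this
    have h0 := Measure.addHaar_submodule (volume : Measure (V → ℂ)) p hp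
    refine measure_mono_null (fun z hz => ?_) h0
    simpa [p, sub_eq_zero] using hz
  have hall : ∀ᵐ z : V → ℂ, ∀ i j : V, i ≠ j → z i ≠ z j := by
    simp only [ae_all_iff]
    exact hdiag
  filter_upwards [hall] with z hz
  refine propext ?_
  change (_ ∧ _) ↔ z ∈ Set.pi Set.univ _
  simp only [Set.mem_pi, Set.mem_univ, true_imp_iff, mem_ball_zero_iff]
  exact ⟨fun h => h.1, fun h => ⟨h, fun i j hij => not_imp_comm.1 (hz i j) (not_not.2 hij)⟩⟩

theorem integral_polydisk_const :
    ∫ _ in Set.pi Set.univ fun _ : U => Metric.ball (0 : ℂ) 1,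
      (1 / Real.pi) ^ Fintype.card U = 1 := by
  rw [setIntegral_const, measureReal_def, volume_pi_pi]
  simp [Complex.volume_ball, Real.pi_ne_zero]

/-- Vertices without edges do not change the weight of a graph. -/
theorem weight_push [DecidableEq W] [DecidableEq U] (σ : W ⊕ U ≃ V) {S : Finset W} (Γ : FGraph S) :
    weight (S.map (inlEmb σ)) (Γ.push (inlEmb σ)) = weight S Γ := by
  unfold weight
  rw [Finset.card_map, setIntegral_congr_set config_ae_eq_ball,
    setIntegral_congr_set config_ae_eq_ball]
  congr 1
  have hset : (Set.pi Set.univ fun _ : V => Metric.ball (0 : ℂ) 1) = splitEquiv σ ⁻¹'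
      ((Set.pi Set.univ fun _ : W => Metric.ball (0 : ℂ) 1) ×ˢ
        (Set.pi Set.univ fun _ : U => Metric.ball (0 : ℂ) 1)) := by
    ext z
    simp only [Set.mem_preimage, splitEquiv_apply, Set.mem_prod, Set.mem_pi, Set.mem_univ,
      true_imp_iff, ← σ.forall_congr_right (q := fun v => z v ∈ Metric.ball (0 : ℂ) 1), Sum.forall]
    rfl
  have hfun : ∀ z : V → ℂ, topCoeff (S.map (inlEmb σ)) (Γ.push (inlEmb σ)) z =
      (fun y : (W → ℂ) × (U → ℂ) => topCoeff S Γ y.1 * (1 / Real.pi) ^ Fintype.card U)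
        (splitEquiv σ z) := fun z => topCoeff_push σ Γ z
  rw [hset, integral_congr_ae (ae_of_all _ hfun)]
  refine ((measurePreserving_splitEquiv σ).setIntegral_preimage_emb
    (splitEquiv σ).measurableEmbedding
    (fun y => topCoeff S Γ y.1 * (1 / Real.pi) ^ Fintype.card U) _).trans ?_
  -- Fubini for a product of functions of separate variables needs no integrability, so convergence
  -- of the weight integrals plays no role.
  rw [Measure.volume_eq_prod,
    setIntegral_prod_mul (fun y => topCoeff S Γ y) (fun _ => (1 / Real.pi) ^ Fintype.card U),
    integral_polydisk_const, mul_one]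

end Embedding

/-! ## The functions of a graph and of its image under an embedding -/

theorem multiD_zero {d : ℕ} (g : (Fin d → ℝ) → ℝ) : multiD 0 g = g := by
  simp [multiD]

section GraphTerm

variable {V W : Type} {d : ℕ}

/-- The differential polynomial of a graph. -/
def graphPoly [Fintype V] [DecidableEq V]
    (d : ℕ) (S : Finset V) (Γ : FGraph S) : DiffPoly d :=
  ∑ I : S × Fin 2 → Fin d,
    (∏ i : S, MvPolynomial.X (.piVar (I (i, 0)) (I (i, 1)) (incoming S Γ I (some i.1))))
    * (∏ i ∈ Sᶜ, MvPolynomial.X (.hVar (incoming S Γ I (some i))))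
    * MvPolynomial.X (.fVar (incoming S Γ I none))

theorem graphPoly_apply [Fintype V] [DecidableEq V]
    (S : Finset V) (Γ : FGraph S) (γ : DegOne d) (f : (Fin d → ℝ) → ℝ)
    (x : Fin d → ℝ) :
    (graphPoly d S Γ).apply γ f x = graphTerm S Γ (fun _ => γ) f x := by
  simp [graphPoly, DiffPoly.apply, graphTerm, jetValue, map_sum, map_prod]

theorem incoming_push [DecidableEq V] [DecidableEq W]
    (e : W ↪ V) {S : Finset W} (Γ : FGraph S) (I : S × Fin 2 → Fin d)
    (o : Option W) :
    incoming (S.map e) (Γ.push e) (I ∘ ((imageEquiv e S).prodCongr (Equiv.refl _)).symm)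
      (o.map e) = incoming S Γ I o := by
  funext ν
  refine (Finset.card_equiv ((imageEquiv e S).prodCongr (Equiv.refl _)) fun p => ?_).symm
  simp only [Finset.mem_filter, Finset.mem_univ, true_and, Function.comp_apply,
    Equiv.symm_apply_apply]
  have h : (Γ.push e).1 (((imageEquiv e S).prodCongr (Equiv.refl _)) p).1
      (((imageEquiv e S).prodCongr (Equiv.refl _)) p).2 = (Γ.1 p.1 p.2).map e :=
    Γ.push_apply e p.1 p.2
  rw [h, (Option.map_injective e.injective).eq_iff]

theorem incoming_push_of_notMem [DecidableEq V]
    (e : W ↪ V) {S : Finset W} (Γ : FGraph S)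
    (I : S.map e × Fin 2 → Fin d) (u : V) (hu : u ∉ Set.range e) :
    incoming (S.map e) (Γ.push e) I (some u) = 0 := by
  funext ν
  refine Finset.card_eq_zero.2 (Finset.filter_eq_empty_iff.2 fun p _ h => hu ?_)
  obtain ⟨w, -, hw⟩ := Option.map_eq_some_iff.1 h.1
  exact ⟨w, hw⟩

/-- Every vertex without edges contributes a factor `h`. -/
theorem graphTerm_push [Fintype V] [DecidableEq V] [Fintype W] [DecidableEq W]
    (e : W ↪ V) {S : Finset W} (Γ : FGraph S) (γ : DegOne d)
    (f : (Fin d → ℝ) → ℝ) (x : Fin d → ℝ) :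
    graphTerm (S.map e) (Γ.push e) (fun _ => γ) f x =
      γ.fn x ^ (Fintype.card V - Fintype.card W) * graphTerm S Γ (fun _ => γ) f x := by
  unfold graphTerm
  rw [← Equiv.sum_comp (((imageEquiv e S).prodCongr (Equiv.refl (Fin 2))).arrowCongr
    (Equiv.refl (Fin d))), Finset.mul_sum]
  refine Finset.sum_congr rfl fun I _ => ?_
  have hI : (((imageEquiv e S).prodCongr (Equiv.refl (Fin 2))).arrowCongr (Equiv.refl (Fin d))) I =
      I ∘ ((imageEquiv e S).prodCongr (Equiv.refl _)).symm := rfl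
  rw [hI]
  have h1 : ∏ i : S.map e, multiD (incoming (S.map e) (Γ.push e)
      (I ∘ ((imageEquiv e S).prodCongr (Equiv.refl _)).symm) (some i.1))
      (γ.biv ((I ∘ ((imageEquiv e S).prodCongr (Equiv.refl _)).symm) (i, 0))
        ((I ∘ ((imageEquiv e S).prodCongr (Equiv.refl _)).symm) (i, 1))) x =
      ∏ i : S, multiD (incoming S Γ I (some i.1)) (γ.biv (I (i, 0)) (I (i, 1))) x := by
    rw [← Equiv.prod_comp (imageEquiv e S)]
    refine Finset.prod_congr rfl fun i _ => ?_
    have hi := incoming_push e Γ I (some i.1)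
    rw [Option.map_some] at hi
    rw [coe_imageEquiv, hi]
    simp
  -- The function vertices of the image are the old ones together with the added ones; the latter
  -- have no incoming edge and yield the power of `h`.
  have hcompl : (S.map e)ᶜ = Sᶜ.map e ∪ (Finset.univ.map e)ᶜ := by
    ext v
    by_cases hv : v ∈ Set.range e
    · obtain ⟨w, rfl⟩ := hv
      simp
    · have hv' : ∀ w, e w ≠ v := fun w h => hv ⟨w, h⟩
      simp [hv']
  have hdisj : Disjoint (Sᶜ.map e) (Finset.univ.map e)ᶜ :=
    Finset.disjoint_left.2 fun v hv hv' =>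
      (Finset.mem_compl.1 hv') (Finset.map_subset_map.2 (Finset.subset_univ _) hv)
  have h2 : ∏ i ∈ (S.map e)ᶜ, multiD (incoming (S.map e) (Γ.push e)
      (I ∘ ((imageEquiv e S).prodCongr (Equiv.refl _)).symm) (some i)) γ.fn x =
      (∏ i ∈ Sᶜ, multiD (incoming S Γ I (some i)) γ.fn x) *
        γ.fn x ^ (Fintype.card V - Fintype.card W) := by
    rw [hcompl, Finset.prod_union hdisj, Finset.prod_map]
    congr 1
    · refine Finset.prod_congr rfl fun i _ => ?_
      have hi := incoming_push e Γ I (some i)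
      rw [Option.map_some] at hi
      rw [hi]
    · rw [Finset.prod_congr rfl (g := fun _ => γ.fn x), Finset.prod_const, Finset.card_compl,
        Finset.card_map, Finset.card_univ]
      intro v hv
      rw [incoming_push_of_notMem e Γ _ v (by simpa using hv), multiD_zero]
  have h3 := incoming_push e Γ I none
  rw [Option.map_none] at h3
  rw [h1, h2, h3]
  ring

/-! ## Sums over graphs -/

/-- The vertices which carry a bivector field or at which an edge ends. -/
def touched [DecidableEq V]
    (S : Finset V) (Γ : FGraph S) : Finset V :=
  S ∪ (Finset.univ.image fun p : S × Fin 2 => Γ.1 p.1 p.2).eraseNone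

theorem touched_push [DecidableEq V] [DecidableEq W]
    (e : W ↪ V) {S : Finset W} (Γ : FGraph S) :
    touched (S.map e) (Γ.push e) = (touched S Γ).map e := by
  ext v
  simp only [touched, Finset.mem_union, Finset.mem_eraseNone, Finset.mem_image, Finset.mem_univ,
    true_and, Prod.exists, Finset.mem_map, ← (imageEquiv e S).exists_congr_right, Γ.push_apply,
    Option.map_eq_some_iff]
  constructor
  · rintro (⟨w, hw, rfl⟩ | ⟨i, a, w, hw, rfl⟩)
    · exact ⟨w, Or.inl hw, rfl⟩
    · exact ⟨w, Or.inr ⟨i, a, hw⟩, rfl⟩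
  · rintro ⟨w, hw | ⟨i, a, hw⟩, rfl⟩
    · exact Or.inl ⟨w, hw, rfl⟩
    · exact Or.inr ⟨i, a, w, hw, rfl⟩

/-- Each bivector vertex accounts for itself and the ends of its two edges. -/
theorem card_touched_le [DecidableEq V]
    (S : Finset V) (Γ : FGraph S) : (touched S Γ).card ≤ 3 * S.card := by
  have h : (Finset.univ.image fun p : S × Fin 2 => Γ.1 p.1 p.2).eraseNone.card ≤ S.card * 2 :=
    (Finset.card_eraseNone_le _).trans (Finset.card_image_le.trans (by simp))
  have := Finset.card_union_le S
    (Finset.univ.image fun p : S × Fin 2 => Γ.1 p.1 p.2).eraseNone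
  unfold touched
  omega

/-- All edges end at touched vertices or at the boundary vertex `none`, so their ends lift along
`e`. The equality is stated in the sigma type because the set of bivector vertices changes along
with the graph. -/
theorem exists_eq_push [DecidableEq V] [Fintype W]
    (e : W ↪ V) (S : Finset V) (Γ : FGraph S)
    (h : touched S Γ ⊆ Finset.univ.map e) :
    ∃ (S' : Finset W) (Γ' : FGraph S'),
      (⟨S, Γ⟩ : Σ S : Finset V, FGraph S) = ⟨S'.map e, Γ'.push e⟩ := by
  obtain ⟨S', -, rfl⟩ := Finset.subset_map_iff.1 (Finset.subset_union_left.trans h)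
  have hex : ∀ (i : S') (a : Fin 2), ∃ o : Option W, o.map e = Γ.1 (imageEquiv e S' i) a := by
    intro i a
    cases hv : Γ.1 (imageEquiv e S' i) a with
    | none => exact ⟨none, rfl⟩
    | some v =>
      have hmem : v ∈ touched _ Γ := Finset.mem_union_right _ (Finset.mem_eraseNone.2
        (Finset.mem_image.2 ⟨(imageEquiv e S' i, a), Finset.mem_univ _, hv⟩))
      obtain ⟨w, -, rfl⟩ := Finset.mem_map.1 (h hmem)
      exact ⟨some w, rfl⟩
  choose t ht using hex
  refine ⟨S', ⟨t, fun i a hi => ?_, fun i hi => ?_⟩, ?_⟩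
  · refine Γ.2.1 (imageEquiv e S' i) a ?_
    rw [← ht, hi]
    rfl
  · refine Γ.2.2 (imageEquiv e S' i) ?_
    rw [← ht, ← ht, hi]
  · congr 1
    refine Subtype.ext (funext fun i => funext fun a => ?_)
    obtain ⟨j, rfl⟩ := (imageEquiv e S').surjective i
    rw [FGraph.push_apply, ht]

theorem push_injective (e : W ↪ V) :
    Function.Injective fun g : Σ S : Finset W, FGraph S =>
      (⟨g.1.map e, g.2.push e⟩ : Σ S : Finset V, FGraph S) := by
  rintro ⟨S, Γ⟩ ⟨S', Γ'⟩ h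
  obtain rfl : S = S' := Finset.map_injective e (Sigma.mk.inj h).1
  congr 1
  have h2 : Γ.push e = Γ'.push e := eq_of_heq (Sigma.mk.inj h).2
  refine Subtype.ext (funext fun i => funext fun a => Option.map_injective e.injective ?_)
  rw [← FGraph.push_apply, h2, FGraph.push_apply]

/-- The graphs with `k` bivector fields all of whose vertices are touched. -/
def cores (V : Type) [Fintype V] [DecidableEq V] (k : ℕ) : Finset (Σ S : Finset V, FGraph S) :=
  Finset.univ.filter fun g => g.1.card = k ∧ touched g.1 g.2 = Finset.univ

/-- The sum of the differential polynomials of the graphs all of whose vertices are touched. -/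
def corePoly (d m k : ℕ) : DiffPoly d :=
  ∑ g ∈ cores (Fin m) k, MvPolynomial.C (weight g.1 g.2) * graphPoly d g.1 g.2

theorem corePoly_apply (m k : ℕ) (γ : DegOne d) (f : (Fin d → ℝ) → ℝ) (x : Fin d → ℝ) :
    (corePoly d m k).apply γ f x =
      ∑ g ∈ cores (Fin m) k, weight g.1 g.2 * graphTerm g.1 g.2 (fun _ => γ) f x := by
  simp only [← graphPoly_apply]
  simp [corePoly, DiffPoly.apply, map_sum]

theorem corePoly_eq_zero {m k : ℕ} (h : 3 * k < m) : corePoly d m k = 0 := by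
  refine Finset.sum_eq_zero fun g hg => ?_
  obtain ⟨hk, ht⟩ := (Finset.mem_filter.1 hg).2
  have := card_touched_le g.1 g.2
  rw [ht, hk, Finset.card_univ, Fintype.card_fin] at this
  omega

/-- Pushing along `e` is a bijection from the cores on `W` onto the graphs on `V` with touched set
the image of `e`; it preserves weights and multiplies the function by a power of `h`. -/
theorem sum_touched_eq [Fintype V] [DecidableEq V] [Fintype W] [DecidableEq W]
    (e : W ↪ V) (k : ℕ) (γ : DegOne d) (f : (Fin d → ℝ) → ℝ) (x : Fin d → ℝ) :
    ∑ g : Σ S : Finset V, FGraph S with g.1.card = k ∧ touched g.1 g.2 = Finset.univ.map e,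
        weight g.1 g.2 * graphTerm g.1 g.2 (fun _ => γ) f x =
      γ.fn x ^ (Fintype.card V - Fintype.card W) *
        ∑ g ∈ cores W k, weight g.1 g.2 * graphTerm g.1 g.2 (fun _ => γ) f x := by
  classical
  let σ : W ⊕ ↥(Set.range e)ᶜ ≃ V :=
    ((Equiv.ofInjective e e.injective).sumCongr (Equiv.refl _)).trans
      (Equiv.Set.sumCompl (Set.range e))
  have hσ : inlEmb σ = e := by
    ext w
    rfl
  rw [Finset.mul_sum]
  symm
  refine Finset.sum_nbij (fun g => ⟨g.1.map e, g.2.push e⟩) ?_ (push_injective e).injOn ?_ ?_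
  · intro g hg
    obtain ⟨hk, ht⟩ := (Finset.mem_filter.1 hg).2
    refine Finset.mem_filter.2 ⟨Finset.mem_univ _, ?_, ?_⟩
    · rw [Finset.card_map, hk]
    · rw [touched_push, ht]
  · rintro ⟨S, Γ⟩ hg
    obtain ⟨hk, ht⟩ := (Finset.mem_filter.1 (Finset.mem_coe.1 hg)).2
    obtain ⟨S', Γ', h⟩ := exists_eq_push e S Γ ht.le
    refine ⟨⟨S', Γ'⟩, ?_, h.symm⟩
    obtain rfl : S = S'.map e := (Sigma.mk.inj h).1
    obtain rfl : Γ = Γ'.push e := eq_of_heq (Sigma.mk.inj h).2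
    refine Finset.mem_coe.2 (Finset.mem_filter.2 ⟨Finset.mem_univ _, ?_, ?_⟩)
    · simpa using hk
    · exact Finset.map_injective e ((touched_push e Γ').symm.trans ht)
  · intro g _
    have hw := weight_push σ g.2
    rw [hσ] at hw
    rw [hw, graphTerm_push]
    ring

/-- The sum over all graphs, by the set of touched vertices. -/
theorem sum_graphs_eq (n k : ℕ) (γ : DegOne d) (f : (Fin d → ℝ) → ℝ) (x : Fin d → ℝ) :
    ∑ g : Σ S : Finset (Fin n), FGraph S with g.1.card = k,
        weight g.1 g.2 * graphTerm g.1 g.2 (fun _ => γ) f x =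
      ∑ m ∈ Finset.range (3 * k + 1),
        (n.choose m : ℝ) * (γ.fn x ^ (n - m) * (corePoly d m k).apply γ f x) := by
  have hT : ∀ T : Finset (Fin n),
      ∑ g : Σ S : Finset (Fin n), FGraph S with g.1.card = k ∧ touched g.1 g.2 = T,
        weight g.1 g.2 * graphTerm g.1 g.2 (fun _ => γ) f x =
      γ.fn x ^ (n - T.card) * (corePoly d T.card k).apply γ f x := by
    intro T
    have h := sum_touched_eq (T.orderEmbOfFin rfl).toEmbedding k γ f x
    rw [Finset.map_orderEmbOfFin_univ, Fintype.card_fin, Fintype.card_fin] at h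
    rw [h, corePoly_apply]
  rw [← Finset.sum_fiberwise (g := fun g => touched g.1 g.2)]
  simp_rw [Finset.filter_filter, hT]
  rw [← Finset.powerset_univ, Finset.sum_powerset_apply_card
    (fun m => γ.fn x ^ (n - m) * (corePoly d m k).apply γ f x)]
  simp only [Finset.card_univ, Fintype.card_fin, nsmul_eq_mul]
  -- Grouping by cardinality gives `m ≤ n`, the claim has `m ≤ 3k`. Both sums extend to a common
  -- range, the binomial vanishing for `m > n` and the core polynomial for `m > 3k`.
  have hz : ∀ m, ¬ (m < n + 1 ∧ m < 3 * k + 1) →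
      (n.choose m : ℝ) * (γ.fn x ^ (n - m) * (corePoly d m k).apply γ f x) = 0 := by
    intro m hm
    rcases not_and_or.1 hm with hm | hm
    · rw [Nat.choose_eq_zero_of_lt (by omega)]
      simp
    · rw [corePoly_eq_zero (by omega)]
      simp [DiffPoly.apply]
  have h1 := Finset.sum_subset
    (Finset.range_mono (show n + 1 ≤ n + 1 + (3 * k + 1) by omega)) fun m _ hm =>
      hz m fun h => hm (Finset.mem_range.2 h.1)
  have h2 := Finset.sum_subset
    (Finset.range_mono (show 3 * k + 1 ≤ n + 1 + (3 * k + 1) by omega)) fun m _ hm =>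
      hz m fun h => hm (Finset.mem_range.2 h.2)
  rw [h1, h2]

end GraphTerm

/-! ## The coefficients in the formal parameter -/

section Coefficients

variable {d : ℕ}

theorem partialD_zero (ν : Fin d) : partialD ν (fun _ => (0 : ℝ)) = fun _ => 0 := by
  funext x
  simp [partialD]

theorem multiD_const_zero (α : Fin d → ℕ) : multiD α (fun _ => (0 : ℝ)) = fun _ => 0 := by
  unfold multiD
  induction List.finRange d with
  | nil => rfl
  | cons a l ih =>
    rw [List.foldr_cons, ih]
    exact Function.iterate_fixed (partialD_zero a) _

theorem epsTwist_biv {γ : DegOne d} {j : ℕ} (hj : j ≠ 1) (μ ν : Fin d) :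
    (epsTwist γ j).biv μ ν = fun _ => 0 := by
  match j, hj with
  | 0, _ => rfl
  | _ + 2, _ => rfl

theorem epsTwist_fn {γ : DegOne d} {j : ℕ} (hj : j ≠ 0) : (epsTwist γ j).fn = fun _ => 0 := by
  match j, hj with
  | 1, _ => rfl
  | _ + 2, _ => rfl

/-- A bivector is available only at order 1 and a function only at order 0, so the indicator of `S`
is the only assignment of orders that survives. -/
theorem graphTerm_epsTwist {V : Type} [Fintype V] [DecidableEq V] (S : Finset V) (Γ : FGraph S)
    (γ : DegOne d) (f : (Fin d → ℝ) → ℝ) (x : Fin d → ℝ) (κ : V → ℕ) :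
    graphTerm S Γ (fun i => epsTwist γ (κ i)) f x =
      if κ = fun i => if i ∈ S then 1 else 0 then graphTerm S Γ (fun _ => γ) f x else 0 := by
  split_ifs with hκ
  · subst hκ
    unfold graphTerm
    refine Finset.sum_congr rfl fun I _ => ?_
    congr 2
    · refine Finset.prod_congr rfl fun i _ => ?_
      simp only [if_pos i.2]
      rfl
    · refine Finset.prod_congr rfl fun i hi => ?_
      simp only [if_neg (Finset.mem_compl.1 hi)]
      rfl
  · obtain ⟨i, hi⟩ := Function.ne_iff.1 hκ
    refine Finset.sum_eq_zero fun I _ => ?_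
    by_cases hS : i ∈ S
    · rw [if_pos hS] at hi
      rw [Finset.prod_eq_zero (Finset.mem_univ (⟨i, hS⟩ : S)), zero_mul, zero_mul]
      rw [epsTwist_biv hi, multiD_const_zero]
    · rw [if_neg hS] at hi
      rw [Finset.prod_eq_zero (Finset.mem_compl.2 hS), mul_zero, zero_mul]
      rw [epsTwist_fn hi, multiD_const_zero]

/-- Only finitely many differential polynomials occur at a given order. -/
theorem FCoeff_eq (γ : DegOne d) (f : (Fin d → ℝ) → ℝ) (n k : ℕ) (x : Fin d → ℝ) :
    FCoeff γ f n k x = ∑ m ∈ Finset.range (3 * k + 1),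
      (n.choose m : ℝ) * (γ.fn x ^ (n - m) * (corePoly d m k).apply γ f x) := by
  rw [← sum_graphs_eq, FCoeff, FEps, PowerSeries.coeff_mk]
  simp only [F, graphTerm_epsTwist, mul_ite, mul_zero]
  rw [Finset.sum_comm, Finset.sum_filter, Fintype.sum_sigma]
  refine Finset.sum_congr rfl fun S _ => ?_
  rw [Finset.sum_comm]
  refine Finset.sum_congr rfl fun Γ _ => ?_
  -- The surviving assignment has total order `|S|`, so it occurs in the sum exactly when `|S| = k`.
  rw [Finset.sum_ite_eq']
  simp [Finset.Nat.mem_antidiagonalTuple]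

end Coefficients

/-! ## Regularity of the partial derivatives -/

section Analysis

variable {d : ℕ} {M : Set (Fin d → ℝ)}

theorem contDiffOn_partialD (hM : IsOpen M) {g : (Fin d → ℝ) → ℝ}
    (hg : ContDiffOn ℝ (⊤ : ℕ∞) g M) (ν : Fin d) :
    ContDiffOn ℝ (⊤ : ℕ∞) (partialD ν g) M :=
  (hg.fderiv_of_isOpen hM (m := (⊤ : ℕ∞)) le_rfl).clm_apply contDiffOn_const

theorem tsupport_partialD_subset (g : (Fin d → ℝ) → ℝ) (ν : Fin d) :
    tsupport (partialD ν g) ⊆ tsupport g :=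
  closure_minimal (fun x hx => by
    refine support_fderiv_subset ℝ (f := g) fun h => hx ?_
    simp [partialD, h]) (isClosed_tsupport g)

/-- A property stable under partial derivatives is stable under iterated ones. -/
theorem multiD_induction {p : ((Fin d → ℝ) → ℝ) → Prop} (hp : ∀ ν g, p g → p (partialD ν g))
    {g : (Fin d → ℝ) → ℝ} (hg : p g) (α : Fin d → ℕ) : p (multiD α g) := by
  unfold multiD
  induction List.finRange d with
  | nil => exact hg
  | cons a l ih => exact Function.Iterate.rec p ih (fun g h => hp a g h) _

theorem contDiffOn_multiD (hM : IsOpen M) {g : (Fin d → ℝ) → ℝ}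
    (hg : ContDiffOn ℝ (⊤ : ℕ∞) g M) (α : Fin d → ℕ) :
    ContDiffOn ℝ (⊤ : ℕ∞) (multiD α g) M :=
  multiD_induction (p := fun g => ContDiffOn ℝ (⊤ : ℕ∞) g M)
    (fun ν _ h => contDiffOn_partialD hM h ν) hg α

theorem tsupport_multiD_subset (g : (Fin d → ℝ) → ℝ) (α : Fin d → ℕ) :
    tsupport (multiD α g) ⊆ tsupport g :=
  multiD_induction (p := fun g' => tsupport g' ⊆ tsupport g)
    (fun ν g' h => (tsupport_partialD_subset g' ν).trans h) subset_rfl α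

theorem continuousOn_apply (hM : IsOpen M) {γ : DegOne d} (hγ : IsMaurerCartan M γ)
    {f : (Fin d → ℝ) → ℝ} (hf : ContDiff ℝ (⊤ : ℕ∞) f) (P : DiffPoly d) :
    ContinuousOn (P.apply γ f) M := by
  refine (MvPolynomial.continuous_eval P).comp_continuousOn (continuousOn_pi.2 fun v => ?_)
  cases v with
  | piVar μ ν α => exact (contDiffOn_multiD hM (hγ.smooth_biv μ ν) α).continuousOn
  | hVar α => exact (contDiffOn_multiD hM hγ.smooth_fn α).continuousOn
  | fVar α => exact (contDiffOn_multiD hM hf.contDiffOn α).continuousOn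

/-- Every monomial has a derivative of `f` as a factor. -/
theorem corePoly_apply_eq_zero (m k : ℕ) (γ : DegOne d) {f : (Fin d → ℝ) → ℝ}
    {x : Fin d → ℝ} (hx : x ∉ tsupport f) : (corePoly d m k).apply γ f x = 0 := by
  rw [corePoly_apply]
  refine Finset.sum_eq_zero fun g _ => ?_
  rw [graphTerm, Finset.sum_eq_zero, mul_zero]
  intro I _
  rw [image_eq_zero_of_notMem_tsupport fun h => hx (tsupport_multiD_subset f _ h), mul_zero]

/-! ## Exponential series -/

/-- The terms with `n < m` vanish, and the shift `n = j + m` turns `C(n,m)/n!` into `1/(m! j!)`. The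
sequence `a` is left general to serve both pointwise and for integrals. -/
theorem hasSum_choose_mul {a : ℕ → ℝ} {s : ℝ}
    (h : HasSum (fun j => 1 / (j.factorial : ℝ) * a j) s) (m : ℕ) :
    HasSum (fun n => 1 / (n.factorial : ℝ) * ((n.choose m : ℝ) * a (n - m)))
      (1 / (m.factorial : ℝ) * s) := by
  have hshift : HasSum (fun j => 1 / ((j + m).factorial : ℝ) *
      (((j + m).choose m : ℝ) * a (j + m - m))) (1 / (m.factorial : ℝ) * s) := by
    refine (h.mul_left _).congr_fun fun j => ?_
    have hc : ((j + m).choose m : ℝ) * j.factorial * m.factorial = (j + m).factorial := by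
      have := Nat.add_choose_mul_factorial_mul_factorial j m
      exact_mod_cast this
    have hj : (j.factorial : ℝ) ≠ 0 := by positivity
    have hm : (m.factorial : ℝ) ≠ 0 := by positivity
    have hjm : ((j + m).factorial : ℝ) ≠ 0 := by positivity
    rw [Nat.add_sub_cancel]
    field_simp
    rw [← hc]
    ring
  refine (hasSum_nat_add_iff' (f := fun n => 1 / (n.factorial : ℝ) *
    ((n.choose m : ℝ) * a (n - m))) m).1 ?_
  rw [Finset.sum_eq_zero, sub_zero]
  · exact hshift
  · intro n hn
    rw [Nat.choose_eq_zero_of_lt (Finset.mem_range.1 hn)]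
    simp

theorem hasSum_pow_mul (y c : ℝ) :
    HasSum (fun j : ℕ => 1 / (j.factorial : ℝ) * (y ^ j * c)) (c * Real.exp y) := by
  have h := (NormedSpace.expSeries_div_hasSum_exp y).mul_left c
  rw [← Real.exp_eq_exp_ℝ] at h
  refine h.congr_fun fun j => ?_
  ring

theorem integrableOn_of_eq_zero {K : Set (Fin d → ℝ)} (hM : IsOpen M) (hK : IsCompact K)
    (hKM : K ⊆ M) {g : (Fin d → ℝ) → ℝ} (hg : ContinuousOn g M) (h0 : ∀ x ∉ K, g x = 0) :
    IntegrableOn g M :=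
  ((hg.mono hKM).integrableOn_compact hK).of_forall_sdiff_eq_zero hM.measurableSet
    fun x hx => h0 x hx.2

theorem hasSum_integral_pow_mul {K : Set (Fin d → ℝ)} (hM : IsOpen M) (hK : IsCompact K)
    (hKM : K ⊆ M) {g h : (Fin d → ℝ) → ℝ} (hg : ContinuousOn g M) (hh : ContinuousOn h M)
    (h0 : ∀ x ∉ K, g x = 0) :
    HasSum (fun j : ℕ => 1 / (j.factorial : ℝ) * ∫ x in M, h x ^ j * g x)
      (∫ x in M, g x * Real.exp (h x)) := by
  -- The dominating series is `C^j |g| / j!`, with sum `|g| e^C`. A negative `C` can occur only for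
  -- empty `K`, and then `g` is zero.
  obtain ⟨C, hC⟩ := hK.exists_bound_of_continuousOn (hh.mono hKM)
  have hsum := hasSum_integral_of_dominated_convergence (μ := volume.restrict M)
    (F := fun (j : ℕ) x => 1 / (j.factorial : ℝ) * (h x ^ j * g x))
    (f := fun x => g x * Real.exp (h x))
    (fun j x => 1 / (j.factorial : ℝ) * (C ^ j * |g x|)) ?_ ?_ ?_ ?_ ?_
  · simpa only [integral_const_mul] using hsum
  · exact fun j => (continuousOn_const.mul ((hh.pow j).mul hg)).aestronglyMeasurable
      hM.measurableSet
  · refine fun j => ae_of_all _ fun x => ?_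
    by_cases hx : x ∈ K
    · rw [norm_mul, norm_mul, norm_pow, Real.norm_of_nonneg (by positivity), Real.norm_eq_abs (g x)]
      gcongr
      exact hC x hx
    · simp [h0 x hx]
  · exact ae_of_all _ fun x => (hasSum_pow_mul C |g x|).summable
  · simp only [(hasSum_pow_mul C |g _|).tsum_eq]
    exact (integrableOn_of_eq_zero hM hK hKM hg h0).abs.mul_const _
  · exact ae_of_all _ fun x => hasSum_pow_mul (h x) (g x)

end Analysis

/-! ## The resummed polynomials -/

/-- The differential polynomial multiplying `e^h` at order `k` in the formal parameter. -/
def resummedPoly (d k : ℕ) : DiffPoly d :=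
  MvPolynomial.C (k.factorial : ℝ) * ∑ m ∈ Finset.range (3 * k + 1),
    MvPolynomial.C (1 / (m.factorial : ℝ)) * corePoly d m k

theorem resummedPoly_apply {d : ℕ} (k : ℕ) (γ : DegOne d) (f : (Fin d → ℝ) → ℝ)
    (x : Fin d → ℝ) :
    1 / (k.factorial : ℝ) * (resummedPoly d k).apply γ f x =
      ∑ m ∈ Finset.range (3 * k + 1), 1 / (m.factorial : ℝ) * (corePoly d m k).apply γ f x := by
  have hk : (k.factorial : ℝ) ≠ 0 := by positivity
  simp [resummedPoly, DiffPoly.apply, map_sum, hk]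

/-- The configuration space is a single point of mass 1, and the empty determinant is 1. -/
theorem weight_empty (Γ : FGraph (∅ : Finset (Fin 0))) : weight ∅ Γ = 1 := by
  have h : ∀ z : Fin 0 → ℂ, topCoeff ∅ Γ z = 1 := fun z => Matrix.det_isEmpty
  have hc : config (Fin 0) = Set.univ :=
    Set.eq_univ_of_forall fun z => ⟨fun i => i.elim0, fun i => i.elim0⟩
  simp [weight, h, hc, measureReal_def, Measure.volume_pi_eq_dirac (0 : Fin 0 → ℂ)]

/-- With no bivector field only `m = 0` occurs, and the only core is the empty graph. -/
theorem resummedPoly_zero_apply {d : ℕ} (γ : DegOne d) (f : (Fin d → ℝ) → ℝ) (x : Fin d → ℝ) :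
    (resummedPoly d 0).apply γ f x = f x := by
  have h := resummedPoly_apply 0 γ f x
  simp only [Nat.factorial_zero, Nat.cast_one, div_one, one_mul, mul_zero, zero_add,
    Finset.range_one, Finset.sum_singleton] at h
  rw [h, corePoly_apply]
  let Γ₀ : FGraph (∅ : Finset (Fin 0)) :=
    ⟨fun i => i.1.elim0, fun i => i.1.elim0, fun i => i.1.elim0⟩
  have hcores : cores (Fin 0) 0 = {⟨∅, Γ₀⟩} := by
    refine Finset.eq_singleton_iff_unique_mem.2 ⟨?_, ?_⟩
    · exact Finset.mem_filter.2 ⟨Finset.mem_univ _, rfl, Subsingleton.elim _ _⟩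
    · rintro ⟨S, Γ⟩ _
      obtain rfl : S = ∅ := Subsingleton.elim _ _
      congr 1
      exact Subtype.ext (funext fun i => i.1.elim0)
  have hinc : ∀ I, incoming (d := d) ∅ Γ₀ I none = 0 := fun I => by
    funext ν
    exact Finset.card_eq_zero.2 (Finset.filter_eq_empty_iff.2 fun p => p.1.1.elim0)
  rw [hcores, Finset.sum_singleton, weight_empty, one_mul]
  simp [graphTerm, hinc, multiD_zero]

end CyclicTrace

end

/-! ### Proof of the proposition -/

open CyclicTrace
theorem proposition4p2 (d : ℕ) :
    ∃ H : ℕ → DiffPoly d,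
      ∀ (M : Set (Fin d → ℝ)), IsOpen M →
      ∀ γ : DegOne d, IsMaurerCartan M γ →
      ∀ f : (Fin d → ℝ) → ℝ, ContDiff ℝ (⊤ : ℕ∞) f → HasCompactSupport f → tsupport f ⊆ M →
        (∀ n k, IntegrableOn (FCoeff γ f n k) M) ∧
        (∀ k, ∀ x ∈ M, HasSum (fun n : ℕ => (1 / (n.factorial : ℝ)) * FCoeff γ f n k x)
          ((1 / (k.factorial : ℝ)) * ((H k).apply γ f x * Real.exp (γ.fn x)))) ∧
        (∀ k, Summable fun n : ℕ => (1 / (n.factorial : ℝ)) * ∫ x in M, FCoeff γ f n k x) ∧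
        (∀ k, IntegrableOn (fun x => (H k).apply γ f x * Real.exp (γ.fn x)) M) ∧
        tau M γ f = PowerSeries.mk (fun k =>
          (1 / (k.factorial : ℝ)) * ∫ x in M, (H k).apply γ f x * Real.exp (γ.fn x)) ∧
        PowerSeries.X ∣ tau M γ f - PowerSeries.C (∫ x in M, f x * Real.exp (γ.fn x)) := by
  refine ⟨resummedPoly d, fun M hM γ hγ f hf hfc hfM => ?_⟩
  have hcont : ∀ m k, ContinuousOn ((corePoly d m k).apply γ f) M :=
    fun m k => continuousOn_apply hM hγ hf _
  have hzero : ∀ m k, ∀ x ∉ tsupport f, (corePoly d m k).apply γ f x = 0 :=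
    fun m k x hx => corePoly_apply_eq_zero m k γ hx
  have hh : ContinuousOn γ.fn M := hγ.smooth_fn.continuousOn
  have hint : ∀ j m k, IntegrableOn (fun x => γ.fn x ^ j * (corePoly d m k).apply γ f x) M :=
    fun j m k => integrableOn_of_eq_zero hM hfc hfM ((hh.pow j).mul (hcont m k))
      fun x hx => by rw [hzero m k x hx, mul_zero]
  have hintexp : ∀ m k,
      IntegrableOn (fun x => (corePoly d m k).apply γ f x * Real.exp (γ.fn x)) M :=
    fun m k => integrableOn_of_eq_zero hM hfc hfM ((hcont m k).mul hh.rexp)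
      fun x hx => by rw [hzero m k x hx, zero_mul]
  have hresum : ∀ k x, 1 / (k.factorial : ℝ) *
      ((resummedPoly d k).apply γ f x * Real.exp (γ.fn x)) =
      ∑ m ∈ Finset.range (3 * k + 1),
        1 / (m.factorial : ℝ) * ((corePoly d m k).apply γ f x * Real.exp (γ.fn x)) := by
    intro k x
    rw [← mul_assoc, resummedPoly_apply, Finset.sum_mul]
    exact Finset.sum_congr rfl fun m _ => mul_assoc _ _ _
  have hFint : ∀ n k, ∫ x in M, FCoeff γ f n k x = ∑ m ∈ Finset.range (3 * k + 1),
      (n.choose m : ℝ) * ∫ x in M, γ.fn x ^ (n - m) * (corePoly d m k).apply γ f x := by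
    intro n k
    simp only [FCoeff_eq]
    rw [integral_finsetSum _ fun m _ => (hint _ m k).const_mul _]
    simp only [integral_const_mul]
  have hH : ∀ k, IntegrableOn (fun x => (resummedPoly d k).apply γ f x * Real.exp (γ.fn x)) M := by
    intro k
    refine integrableOn_of_eq_zero hM hfc hfM ((continuousOn_apply hM hγ hf _).mul hh.rexp)
      fun x hx => ?_
    -- Off the support of `f` all core terms vanish, and the nonzero factor `1/k!` cancels.
    have h := hresum k x
    simp only [hzero _ k x hx, zero_mul, mul_zero, Finset.sum_const_zero] at h
    exact (mul_eq_zero.1 h).resolve_left (by positivity)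
  have hHint : ∀ k, 1 / (k.factorial : ℝ) *
      ∫ x in M, (resummedPoly d k).apply γ f x * Real.exp (γ.fn x) =
      ∑ m ∈ Finset.range (3 * k + 1), 1 / (m.factorial : ℝ) *
        ∫ x in M, (corePoly d m k).apply γ f x * Real.exp (γ.fn x) := by
    intro k
    rw [← integral_const_mul]
    simp only [hresum]
    rw [integral_finsetSum _ fun m _ => (hintexp m k).const_mul _]
    simp only [integral_const_mul]
  have hsum : ∀ k, HasSum (fun n : ℕ => 1 / (n.factorial : ℝ) * ∫ x in M, FCoeff γ f n k x)
      (1 / (k.factorial : ℝ) *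
        ∫ x in M, (resummedPoly d k).apply γ f x * Real.exp (γ.fn x)) := by
    intro k
    simp only [hFint, hHint, Finset.mul_sum]
    exact hasSum_sum fun m _ => hasSum_choose_mul
      (a := fun j => ∫ x in M, γ.fn x ^ j * (corePoly d m k).apply γ f x)
      (hasSum_integral_pow_mul hM hfc hfM (hcont m k) hh (hzero m k)) m
  have htau : tau M γ f = PowerSeries.mk fun k => 1 / (k.factorial : ℝ) *
      ∫ x in M, (resummedPoly d k).apply γ f x * Real.exp (γ.fn x) := by
    ext k
    simp only [tau, PowerSeries.coeff_mk]
    exact (hsum k).tsum_eq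
  refine ⟨fun n k => ?_, fun k x _ => ?_, fun k => (hsum k).summable, hH, htau, ?_⟩
  · have : FCoeff γ f n k = fun x => ∑ m ∈ Finset.range (3 * k + 1),
        (n.choose m : ℝ) * (γ.fn x ^ (n - m) * (corePoly d m k).apply γ f x) :=
      funext fun x => FCoeff_eq γ f n k x
    rw [this]
    exact integrable_finsetSum _ fun m _ => (hint _ m k).const_mul _
  · simp only [FCoeff_eq, hresum, Finset.mul_sum]
    exact hasSum_sum fun m _ => hasSum_choose_mul
      (a := fun j => γ.fn x ^ j * (corePoly d m k).apply γ f x) (hasSum_pow_mul _ _) m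
  -- Divisibility by `X` is vanishing of the constant coefficient, which follows from `H_0 = f`.
  · rw [PowerSeries.X_dvd_iff, htau, map_sub]
    simp [← PowerSeries.coeff_zero_eq_constantCoeff_apply, resummedPoly_zero_apply]
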